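/- **Setting.** Let $\mathfrak g$ be a finite-dimensional semisimple Lie algebra over a field $K$ of characteristic $0$, $\mathfrak h$ a splitting Cartan subalgebra, $\Sigma$ the root system, $W$ its Weyl group, $\Delta$ a base of simple roots, and $\mathrm{ht}(\sum_{\alpha\in\Delta}\lambda_\alpha\alpha)=\sum_{\alpha\in\Delta}\lambda_\alpha$. Denote by $h_\alpha\in\mathfrak h$ the coroot of $\alpha$ and by $\mathfrak g_\alpha$ its root space. Fix a *frame*: for each $\alpha\in\Delta$ elements $e_\alpha\in\mathfrak g_\alpha$ and $e_{-\alpha}\in\mathfrak g_{-\alpha}$ with $[e_\alpha,e_{-\alpha}]=-h_\alpha$. Let $\theta$ be the Chevalley involution of the frame, that is, the automorphism of $\mathfrak g$ that interchanges $e_\alpha$ and $e_{-\alpha}$ for every $\alpha\in\Delta$ (it acts as $-1$ on $\mathfrak h$); write $x^\theta=\theta(x)$. **Kottwitz basis.** For $\alpha\in\Delta$ let $\dot s_\alpha=\exp(\mathrm{ad}\,e_\alpha)\exp(\mathrm{ad}\,e_{-\alpha})\exp(\mathrm{ad}\,e_\alpha)$, and for $w\in W$ let $\dot w=\dot s_{\alpha_1}\cdots\dot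 s_{\alpha_n}$, where $w=s_{\alpha_1}\cdots s_{\alpha_n}$ is a reduced expression. For roots $\beta,\gamma$ let $\langle\langle\beta,\gamma\rangle\rangle$ be $\langle\beta,\gamma^\vee\rangle$ if this is positive, the largest integer $p$ such that $\beta-p\gamma$ is a root if $\langle\beta,\gamma^\vee\rangle=0$, and $0$ otherwise. Put $R_w=\{\gamma>0 : w\gamma<0\}$ and $F(w,\beta)=\sum_{\gamma\in R_w}\langle\langle\beta,\gamma\rangle\rangle$. The Kottwitz lift $w^{\triangle}$ of $w$ acts on $v\in\mathfrak g_\beta$ by $w^{\triangle}v=(-1)^{F(w,\beta)}\,\dot w v$. Choose one simple root in each $W$-orbit in $\Sigma$. For every root $\gamma$ put $\mathfrak k_\gamma=w^{\triangle}e_\alpha$, where $\alpha$ is the chosen simple root in the orbit of $\gamma$ and $w\in W$ is any element with $w\alpha=\gamma$. **Theorem.** For every root $\gamma$ and every Kottwitz basis $(\mathfrak k_\gamma)$, whatever the choices of the elements $w$ and of their reduced expressions, $$\mathfrak k_\gamma^{\theta}=(-1)^{\mathrm{ht}(\gamma)-1}\,\mathfrak k_{-\gamma}.$$ In particular $\mathfrak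 k_\alpha^{\theta}=\mathfrak k_{-\alpha}$ for every simple root $\alpha$. -/

import Mathlib

open LieAlgebra LieAlgebra.IsKilling

namespace KottwitzBasis

noncomputable section

section RootCombinatorics

variable {ι R M N : Type*} [Finite ι] [CommRing R] [CharZero R] [IsDomain R]
  [AddCommGroup M] [Module R M] [AddCommGroup N] [Module R N]
  {P : RootPairing ι R M N} [P.IsCrystallographic]

/-- The product in the Weyl group of the simple reflections listed in a word. -/
def wordProd (b : P.Base) (l : List b.support) : P.weylGroup :=
  (l.map fun i => RootPairing.weylGroup.ofIdx P (i : ι)).prod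

/-- The word `l` is a reduced expression of `w`: its product is `w` and no word in the simple
reflections with product `w` is shorter. -/
def IsReducedExpression (b : P.Base) (l : List b.support) (w : P.weylGroup) : Prop :=
  wordProd b l = w ∧ ∀ l' : List b.support, wordProd b l' = w → l.length ≤ l'.length

/-- The root `w β`. The Weyl group acts on roots through their indices, and
`g • P.root i = P.root (P.weylGroupToPerm g i)`. -/
def act (w : P.weylGroup) (β : ι) : ι := P.weylGroupToPerm w β

/-- The set `R_w` of positive roots `γ` such that `w γ` is negative. -/
def inversionSet (b : P.Base) (w : P.weylGroup) : Set ι :=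
  {γ | 0 < b.height γ ∧ b.height (act w γ) < 0}

variable (P) in
/-- The symbol `⟪β, γ⟫`, which equals `⟨β, γ^∨⟩` if this integer is positive, the largest `p` such
that `β - p γ` is a root if `⟨β, γ^∨⟩ = 0`, and `0` otherwise. -/
def term (β γ : ι) : ℕ :=
  if 0 < P.pairingIn ℤ β γ then (P.pairingIn ℤ β γ).toNat
  else if P.pairingIn ℤ β γ = 0 then P.chainBotCoeff γ β
  else 0

/-- `F(w, β)`, the sum of `⟪β, γ⟫` over `γ` in `R_w`. -/
def cocycle (b : P.Base) (w : P.weylGroup) (β : ι) : ℕ :=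
  ∑ᶠ γ ∈ inversionSet b w, term P β γ

/-- `D` consists of simple roots, exactly one in each orbit of the Weyl group on the roots. -/
def IsOrbitChoice (b : P.Base) (D : Set ι) : Prop :=
  D ⊆ b.support ∧ ∀ γ : ι, ∃! α : ι, α ∈ D ∧ ∃ w : P.weylGroup, act w α = γ

end RootCombinatorics

variable {K L : Type*} [Field K] [CharZero K] [LieRing L] [LieAlgebra K L]
  [IsKilling K L] [FiniteDimensional K L]
  {H : LieSubalgebra K L} [H.IsCartanSubalgebra] [LieModule.IsTriangularizable K H L]

/-- The root `-γ`. -/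
def negRoot (γ : H.root) : H.root :=
  ⟨-γ.1, by simpa using (LieSubalgebra.isNonZero_coe_root γ)⟩

/-- A frame: root vectors `e α` and `e' α` (the latter usually written `e_{-α}`) for the roots `α`
and `-α`, for each simple root `α`, normalized by `[e_α, e_{-α}] = -h_α`, with `h_α` the coroot of
`α`. Thus `e α ≠ 0` determines `e' α`, and `(h_α, e α, -e' α)` is a standard `sl₂`-triple. -/
structure Frame (b : (rootSystem H).Base) where
  e : b.support → L
  e' : b.support → L
  e_mem (α : b.support) : e α ∈ rootSpace H (α : H.root).1
  e'_mem (α : b.support) : e' α ∈ rootSpace H (-(α : H.root).1)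
  lie_e_e' (α : b.support) : ⁅e α, e' α⁆ = -(coroot (α : H.root).1 : L)

/-- The exponential of `ad x`, for `ad`-nilpotent `x`. -/
def expAd (K : Type*) {L : Type*} [Field K] [CharZero K] [LieRing L] [LieAlgebra K L] (x : L) :
    Module.End K L :=
  letI : Module ℚ (Module.End K L) := Module.compHom _ (algebraMap ℚ K)
  IsNilpotent.exp (ad K L x)

namespace Frame

variable {b : (rootSystem H).Base} (E : Frame b)

/-- The adjoint action of the canonical lift `exp(e_α) exp(e_{-α}) exp(e_α)` of the simple
reflection `s_α` to the normalizer of the torus. -/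
def simpleLift (α : b.support) : Module.End K L :=
  expAd K (E.e α) * expAd K (E.e' α) * expAd K (E.e α)

/-- The product of the lifts of the simple reflections in a word. For a reduced expression of `w`
this is the adjoint action of the Tits lift of `w`. -/
def titsLift (l : List b.support) : Module.End K L :=
  (l.map E.simpleLift).prod

/-- `E.IsKottwitzLift w β T` says that `T` is, as a map on the root space of `β`, the Kottwitz lift
of `w`: the Tits lift of `w`, computed from some reduced expression, times `(-1) ^ F(w, β)`. -/
def IsKottwitzLift (w : (rootSystem H).weylGroup) (β : H.root) (T : Module.End K L) : Prop :=
  ∃ l : List b.support, IsReducedExpression b l w ∧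
    T = (-1 : K) ^ cocycle b w β • E.titsLift l

/-- `k` is the Kottwitz basis attached to the frame `E` and to the choice `D` of one simple root in
each orbit: every `k γ` is obtained from `e_α`, for the `α` in `D` conjugate to `γ`, by applying the
Kottwitz lift of some `w` with `w α = γ`. No coherence between the choices of `w` and of its reduced
expression for the various `γ` is required. -/
def IsKottwitzBasis (D : Set H.root) (k : H.root → L) : Prop :=
  ∀ γ : H.root, ∃ α : b.support, (α : H.root) ∈ D ∧
    ∃ w : (rootSystem H).weylGroup, act w (α : H.root) = γ ∧
      ∃ T : Module.End K L, E.IsKottwitzLift w α T ∧ k γ = T (E.e α)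

/-- `θ` is the Chevalley involution of the frame: the (unique) automorphism of the Lie algebra that
interchanges `e_α` and `e_{-α}` for every simple root `α`. Since `[e_α, e_{-α}] = -h_α`, it then acts
as `-1` on the Cartan subalgebra; with `f_α = -e_{-α}` it is `e_α ↦ -f_α`, `f_α ↦ -e_α`. -/
structure IsChevalleyInvolution (θ : L ≃ₗ⁅K⁆ L) : Prop where
  map_e (α : b.support) : θ (E.e α) = E.e' α
  map_e' (α : b.support) : θ (E.e' α) = E.e α

end Frame

end

end KottwitzBasis

set_option linter.unusedSectionVars false

/-! Let each simple reflection act by its Kottwitz lift on pairs (root, vector of its root space);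
this is `step`. Prefixing a letter to a reduced word adds one term to F, so a Kottwitz lift is the
composite of the steps along any reduced expression (`foldr_step_of_isReducedExpression`). The signs
make each step an involution (`step_step`) that is trivial when it fixes the root.

Transport along steps then depends only on its endpoints. Raise a root by simple reflections as long
as possible. Two competing raises of γ by α_i and α_j close up to a square if α_i and α_j are
orthogonal. Otherwise γ, α_i, α_j are pairwise obtuse, which forces γ = -(α_i + α_j), and only the
A₂ braid relation on that root space is needed (`step_confluent`). By the diamond argument the final
pair, `normalForm`, is invariant under steps; since steps are injective, it determines the vector
once the root is known.

Finally, θ commutes with the lifts of simple reflections, because the triple product of exponentials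
is unchanged when e_α and e_{-α} are exchanged. The parity of ⟪-β,α⟫ - ⟪β,α⟫ is that of ⟨β,α^∨⟩, the
drop in height under s_α for simple α, so θ with the sign (-1)^(ht - 1) commutes with steps
(`twist_step`). It sends (α, e_α) to a step of (α, e_α). Hence the image of (γ, k_γ) and the pair
(-γ, k_{-γ}) are both reached from (α, e_α) and lie over the same root, so they agree. -/

namespace KottwitzBasis

noncomputable section

/-! ### Obtuse triples, Weyl group invariance, reduced words -/

section RootCombinatorics

variable {ι R M N : Type*} [Finite ι] [CommRing R] [CharZero R] [IsDomain R]
  [AddCommGroup M] [Module R M] [AddCommGroup N] [Module R N]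
  {P : RootPairing ι R M N} [P.IsCrystallographic]

/-- Three roots with pairwise obtuse angles sum to zero, like the simple roots and the lowest root
of a root system of type `A₂`. -/
lemma root_add_root_add_root_eq_zero_of_pairingIn_neg {i j k : ι} (hij : P.pairingIn ℤ i j < 0)
    (hjk : P.pairingIn ℤ j k < 0) (hki : P.pairingIn ℤ k i < 0) :
    P.root i + P.root j + P.root k = 0 := by
  have := Fintype.ofFinite ι
  let B := P.posRootForm ℤ
  let r := P.rootSpanMem ℤ
  have two_mul_form (a b : ι) :
      2 * B.posForm (r a) (r b) = P.pairingIn ℤ a b * B.posForm (r b) (r b) := by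
    apply FaithfulSMul.algebraMap_injective ℤ R
    rw [map_mul, map_mul, P.algebraMap_pairingIn, B.algebraMap_posForm, B.algebraMap_posForm]
    simpa using! B.two_mul_apply_root_root a b
  have form_comm (a b : ι) : B.posForm (r a) (r b) = B.posForm (r b) (r a) :=
    B.isSymm_posForm.eq _ _
  have form_pos (a : ι) : 0 < B.posForm (r a) (r a) := B.rootLength_pos a
  have bound {a b : ι} (h : P.pairingIn ℤ a b < 0) :
      2 * B.posForm (r a) (r b) ≤ -B.posForm (r a) (r a) ∧
        2 * B.posForm (r a) (r b) ≤ -B.posForm (r b) (r b) := by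
    have h' := (P.pairingIn_lt_zero_iff ℤ).mp h
    have h₁ := two_mul_form a b
    have h₂ := two_mul_form b a
    rw [form_comm b a] at h₂
    constructor <;> nlinarith [form_pos a, form_pos b]
  -- Charging each cross term to a different square by `bound` gives |i + j + k|² ≤ 0.
  have hx : r i + r j + r k = 0 := by
    by_contra hne
    have hpos := P.posRootForm_posForm_pos_of_ne_zero ℤ hne
    change 0 < B.posForm _ _ at hpos
    simp only [map_add, LinearMap.add_apply] at hpos
    linarith [(bound hij).1, (bound hjk).1, (bound hki).1, form_comm j i, form_comm k j,
      form_comm k i]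
  simpa using! congr_arg Subtype.val hx

lemma pairingIn_eq_neg_one_of_pairingIn_neg {i j k : ι} (hij : P.pairingIn ℤ i j < 0)
    (hjk : P.pairingIn ℤ j k < 0) (hki : P.pairingIn ℤ k i < 0) :
    P.pairingIn ℤ i j = -1 := by
  have h := congr_arg (P.coroot' j) (root_add_root_add_root_eq_zero_of_pairingIn_neg hij hjk hki)
  have hkj := (P.pairingIn_lt_zero_iff ℤ).mp hjk
  have h' : P.pairingIn ℤ i j + 2 + P.pairingIn ℤ k j = 0 := by
    apply FaithfulSMul.algebraMap_injective ℤ R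
    rw [map_add, map_add, P.algebraMap_pairingIn, P.algebraMap_pairingIn]
    simpa using h
  omega

lemma act_mul (w w' : P.weylGroup) (β : ι) : act (w * w') β = act w (act w' β) := by
  simp [act]

@[simp]
lemma act_one (β : ι) : act (1 : P.weylGroup) β = β := by
  simp [act]

@[simp]
lemma act_ofIdx (i β : ι) : act (RootPairing.weylGroup.ofIdx P i) β = P.reflectionPerm i β := rfl

lemma root_act (w : P.weylGroup) (β : ι) : P.root (act w β) = w • P.root β :=
  (P.weylGroup_apply_root w β).symm

lemma act_inv_act (w : P.weylGroup) (β : ι) : act w⁻¹ (act w β) = β := by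
  rw [← act_mul, inv_mul_cancel, act_one]

lemma act_act_inv (w : P.weylGroup) (β : ι) : act w (act w⁻¹ β) = β := by
  rw [← act_mul, mul_inv_cancel, act_one]

lemma pairing_act (w : P.weylGroup) (β γ : ι) :
    P.pairing (act w β) (act w γ) = P.pairing β γ := by
  obtain ⟨w, hw⟩ := w
  induction hw using RootPairing.weylGroup.induction generalizing β γ with
  | mem i =>
    change P.pairing (P.reflectionPerm i β) (P.reflectionPerm i γ) = _
    simp [RootPairing.pairing_reflectionPerm]
  | one => rfl
  | mul x y hx hy ihx ihy =>
    exact (ihx _ _).trans (ihy β γ)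

lemma pairingIn_act (w : P.weylGroup) (β γ : ι) :
    P.pairingIn ℤ (act w β) (act w γ) = P.pairingIn ℤ β γ := by
  apply FaithfulSMul.algebraMap_injective ℤ R
  rw [P.algebraMap_pairingIn, P.algebraMap_pairingIn, pairing_act]

lemma smul_mem_range_root_iff (w : P.weylGroup) (x : M) :
    w • x ∈ Set.range P.root ↔ x ∈ Set.range P.root := by
  constructor
  · rintro ⟨k, hk⟩
    exact ⟨act w⁻¹ k, by rw [root_act, hk, inv_smul_smul]⟩
  · rintro ⟨k, rfl⟩
    exact ⟨act w k, root_act w k⟩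

lemma linearIndependent_act_iff (w : P.weylGroup) (β γ : ι) :
    LinearIndependent R ![P.root (act w β), P.root (act w γ)] ↔
      LinearIndependent R ![P.root β, P.root γ] := by
  have key (s t : R) : s • P.root (act w β) + t • P.root (act w γ) =
      w • (s • P.root β + t • P.root γ) := by
    rw [root_act, root_act, smul_add, smul_comm w s, smul_comm w t]
  simp only [LinearIndependent.pair_iff, key, smul_eq_zero_iff_eq]

/-- For independent roots the coefficient records which γ - nβ are roots, a W-invariant condition;
for dependent ones it is 0 by convention. -/
lemma chainBotCoeff_act (w : P.weylGroup) (β γ : ι) :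
    P.chainBotCoeff (act w β) (act w γ) = P.chainBotCoeff β γ := by
  by_cases h : LinearIndependent R ![P.root β, P.root γ]
  · have h' := (linearIndependent_act_iff w β γ).mpr h
    refine eq_of_forall_le_iff fun n ↦ ?_
    rw [← P.root_sub_nsmul_mem_range_iff_le_chainBotCoeff h,
      ← P.root_sub_nsmul_mem_range_iff_le_chainBotCoeff h', root_act, root_act,
      ← smul_mem_range_root_iff w (P.root γ - n • P.root β), smul_sub, smul_comm w n]
  · rw [P.chainBotCoeff_of_not_linearIndependent h, P.chainBotCoeff_of_not_linearIndependent
      (mt (linearIndependent_act_iff w β γ).mp h)]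

lemma term_act (w : P.weylGroup) (β γ : ι) : term P (act w β) (act w γ) = term P β γ := by
  simp [term, pairingIn_act, chainBotCoeff_act]

lemma root_reflectionPerm_eq_sub (i β : ι) :
    P.root (P.reflectionPerm i β) = P.root β - P.pairingIn ℤ β i • P.root i := by
  rw [P.root_reflectionPerm, P.reflection_apply_root' ℤ]

variable (b : P.Base)

@[simp]
lemma wordProd_nil : wordProd b [] = 1 := by
  simp [wordProd]

@[simp]
lemma wordProd_cons (i : b.support) (l : List b.support) :
    wordProd b (i :: l) = RootPairing.weylGroup.ofIdx P (i : ι) * wordProd b l := by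
  simp [wordProd]

lemma height_reflectionPerm {i : ι} (hi : i ∈ b.support) (β : ι) :
    b.height (P.reflectionPerm i β) = b.height β - P.pairingIn ℤ β i := by
  have h : P.root (P.reflectionPerm i β) = P.root β + (-P.pairingIn ℤ β i) • P.root i := by
    rw [root_reflectionPerm_eq_sub, neg_smul, sub_eq_add_neg]
  rw [b.height_add_zsmul h, b.height_one_of_mem_support hi]
  simp [sub_eq_add_neg]

lemma ofIdx_mul_self (i : ι) :
    RootPairing.weylGroup.ofIdx P i * RootPairing.weylGroup.ofIdx P i = 1 := by
  apply Subtype.ext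
  change RootPairing.Equiv.reflection P i * RootPairing.Equiv.reflection P i = 1
  nth_rw 1 [← RootPairing.Equiv.reflection_inv]
  exact inv_mul_cancel _

lemma ofIdx_reflectionPerm_mul (i β : ι) :
    RootPairing.weylGroup.ofIdx P (P.reflectionPerm i β) * RootPairing.weylGroup.ofIdx P i =
      RootPairing.weylGroup.ofIdx P i * RootPairing.weylGroup.ofIdx P β := by
  apply Subtype.ext
  apply RootPairing.Equiv.weightHom_injective P
  ext x
  change P.reflection (P.reflectionPerm i β) (P.reflection i x) =
    P.reflection i (P.reflection β x)
  simp [RootPairing.reflection_reflectionPerm]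

variable {b} [P.IsReduced]

/-- The exchange condition for a word in the simple reflections. -/
lemma exists_wordProd_eq_ofIdx_mul (l : List b.support) {β : ι} (hβ : 0 < b.height β)
    (h : b.height (act (wordProd b l)⁻¹ β) < 0) :
    ∃ l' : List b.support, l'.length < l.length ∧
      wordProd b l' = RootPairing.weylGroup.ofIdx P β * wordProd b l := by
  induction l generalizing β with
  | nil =>
    simp only [wordProd_nil, inv_one, act_one] at h
    omega
  | cons i l ih =>
    -- Since s_i permutes the positive roots other than α_i, β can turn negative only at a letter
    -- where it has become simple; that letter is deleted.
    rcases eq_or_ne β i with rfl | hne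
    · exact ⟨l, by simp, by rw [wordProd_cons, ← mul_assoc, ofIdx_mul_self, one_mul]⟩
    · have hinv : (RootPairing.weylGroup.ofIdx P (i : ι))⁻¹ = RootPairing.weylGroup.ofIdx P i :=
        inv_eq_of_mul_eq_one_left (ofIdx_mul_self _)
      rw [wordProd_cons, mul_inv_rev, act_mul, hinv, act_ofIdx] at h
      obtain ⟨l', hl', hw⟩ := ih (RootPairing.Base.IsPos.reflectionPerm hβ i.2 hne) h
      refine ⟨i :: l', by simpa using hl', ?_⟩
      rw [wordProd_cons, wordProd_cons, hw, ← mul_assoc, ← mul_assoc,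
        ← ofIdx_reflectionPerm_mul, P.reflectionPerm_self]

variable {i : b.support} {l : List b.support}

lemma IsReducedExpression.tail (h : IsReducedExpression b (i :: l) (wordProd b (i :: l))) :
    IsReducedExpression b l (wordProd b l) := by
  refine ⟨rfl, fun l' hl' ↦ ?_⟩
  simpa using h.2 (i :: l') (by rw [wordProd_cons, wordProd_cons, hl'])

lemma IsReducedExpression.height_pos (h : IsReducedExpression b (i :: l) (wordProd b (i :: l))) :
    0 < b.height (act (wordProd b l)⁻¹ i) := by
  by_contra hneg
  have hneg : b.height (act (wordProd b l)⁻¹ i) < 0 :=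
    lt_of_le_of_ne (not_lt.mp hneg) (b.height_ne_zero _)
  obtain ⟨l', hl', hw⟩ := exists_wordProd_eq_ofIdx_mul l
    (by simp [b.height_one_of_mem_support i.2]) hneg
  have := h.2 l' (by rw [hw, wordProd_cons])
  simp only [List.length_cons] at this
  omega

/-- Only ±α_i change sign under s_i. The case wγ = α_i is the new inversion; wγ = -α_i is impossible
for γ > 0, as w⁻¹α_i > 0 by the exchange condition. -/
lemma IsReducedExpression.inversionSet_cons
    (h : IsReducedExpression b (i :: l) (wordProd b (i :: l))) :
    inversionSet b (wordProd b (i :: l)) =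
      insert (act (wordProd b l)⁻¹ i) (inversionSet b (wordProd b l)) := by
  have hpos := h.height_pos
  ext γ
  simp only [inversionSet, wordProd_cons, act_mul, act_ofIdx, Set.mem_ofPred_eq,
    Set.mem_insert_iff]
  set w := wordProd b l
  have hi := b.height_one_of_mem_support i.2
  rcases eq_or_ne (act w γ) i with hγ | hγ
  · have : γ = act w⁻¹ i := by rw [← hγ, act_inv_act]
    simp only [hγ, height_reflectionPerm b i.2, hi, P.pairingIn_same]
    simp [this, hpos]
  have hγ₁ : γ ≠ act w⁻¹ i := fun e ↦ hγ (by rw [e, act_act_inv])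
  simp only [hγ₁, false_or, and_congr_right_iff]
  intro hγ₀
  let := P.indexNeg
  rcases eq_or_ne (act w γ) (-(i : ι)) with hγ' | hγ'
  · have : γ = -(act w⁻¹ i) := by
      apply P.root.injective
      have root_neg (δ : ι) : P.root (-δ) = -P.root δ := by simp
      rw [← act_inv_act w γ, hγ', root_act, root_neg, root_neg, root_act, smul_neg]
    rw [this, b.height_reflectionPerm_self] at hγ₀
    omega
  have key {δ : ι} (hδ : δ ≠ i) (h0 : 0 < b.height δ) : 0 < b.height (P.reflectionPerm i δ) :=
    RootPairing.Base.IsPos.reflectionPerm h0 i.2 hδ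
  constructor
  · intro h1
    by_contra h2
    have h2 := lt_of_le_of_ne (not_lt.mp h2) (b.height_ne_zero _).symm
    have := key hγ h2
    omega
  · intro h1
    have h2 : 0 < b.height (-(act w γ)) := by rw [b.height_reflectionPerm_self]; omega
    have h3 := key (fun e ↦ hγ' (by rw [← e, neg_neg])) h2
    have h4 := height_reflectionPerm b i.2 (act w γ)
    rw [height_reflectionPerm b i.2, b.height_reflectionPerm_self, P.indexNeg_neg,
      P.pairingIn_reflectionPerm_self_left] at h3
    omega

/-- The new inversion contributes ⟪β, w⁻¹α_i⟫ = ⟪wβ, α_i⟫ by W-invariance. -/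
lemma IsReducedExpression.cocycle_cons
    (h : IsReducedExpression b (i :: l) (wordProd b (i :: l))) (β : ι) :
    cocycle b (wordProd b (i :: l)) β =
      term P (act (wordProd b l) β) i + cocycle b (wordProd b l) β := by
  have hnot : act (wordProd b l)⁻¹ i ∉ inversionSet b (wordProd b l) := by
    simp [inversionSet, act_act_inv, b.height_one_of_mem_support i.2]
  rw [cocycle, h.inversionSet_cons, finsum_mem_insert _ hnot (Set.toFinite _), cocycle,
    ← term_act (wordProd b l) β, act_act_inv]

lemma cocycle_nil (β : ι) : cocycle b (wordProd b []) β = 0 := by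
  have : inversionSet b (wordProd b []) = ∅ := by
    ext γ
    simp only [inversionSet, wordProd_nil, act_one, Set.mem_ofPred_eq,
      Set.mem_empty_iff_false, iff_false]
    omega
  simp only [cocycle, this]
  simp

end RootCombinatorics

/-! ### Exponentials of nilpotent adjoint maps -/

section Exponential

variable {K L : Type*} [Field K] [CharZero K] [LieRing L] [LieAlgebra K L]

lemma expAd_eq_sum {x : L} {n : ℕ} (h : ad K L x ^ n = 0) :
    expAd K x = ∑ i ∈ Finset.range n, (i.factorial : K)⁻¹ • ad K L x ^ i := by
  let : Module ℚ (Module.End K L) := Module.compHom _ (algebraMap ℚ K)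
  refine (IsNilpotent.exp_eq_sum h).trans (Finset.sum_congr rfl fun i _ ↦ ?_)
  change (algebraMap ℚ K) (i.factorial : ℚ)⁻¹ • ad K L x ^ i = _
  simp

lemma expAd_apply {x v : L} (hx : IsNilpotent (ad K L x)) {n : ℕ} (h : (ad K L x ^ n) v = 0) :
    expAd K x v = ∑ i ∈ Finset.range n, (i.factorial : K)⁻¹ • (ad K L x ^ i) v := by
  obtain ⟨m, hm⟩ := hx
  have hm' : ad K L x ^ (m + n) = 0 := by rw [pow_add, hm, zero_mul]
  rw [expAd_eq_sum hm', LinearMap.sum_apply]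
  refine (Finset.sum_subset (by simp) fun i _ hi ↦ ?_).symm
  obtain ⟨j, rfl⟩ := Nat.exists_eq_add_of_le' (not_lt.mp (Finset.mem_range.not.mp hi))
  rw [LinearMap.smul_apply, pow_add, Module.End.mul_apply, h, map_zero, smul_zero]

lemma expAd_apply_of_lie_eq_zero {x v : L} (hx : IsNilpotent (ad K L x)) (h : ⁅x, v⁆ = 0) :
    expAd K x v = v := by
  rw [expAd_apply hx (n := 1) (by simpa using h)]
  simp

lemma expAd_apply_of_lie_lie_eq_zero {x v : L} (hx : IsNilpotent (ad K L x))
    (h : ⁅x, ⁅x, v⁆⁆ = 0) : expAd K x v = v + ⁅x, v⁆ := by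
  rw [expAd_apply hx (n := 2) (by simpa [pow_succ] using h)]
  simp [Finset.sum_range_succ]

lemma expAd_apply_of_lie_lie_lie_eq_zero {x v : L} (hx : IsNilpotent (ad K L x))
    (h : ⁅x, ⁅x, ⁅x, v⁆⁆⁆ = 0) :
    expAd K x v = v + ⁅x, v⁆ + (2 : K)⁻¹ • ⁅x, ⁅x, v⁆⁆ := by
  rw [expAd_apply hx (n := 3) (by simpa [pow_succ] using h)]
  simp [Finset.sum_range_succ, pow_succ]

lemma expAd_apply_expAd_neg_apply {x : L} (hx : IsNilpotent (ad K L x)) (v : L) :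
    expAd K x (expAd K (-x) v) = v := by
  let : Module ℚ (Module.End K L) := Module.compHom _ (algebraMap ℚ K)
  have h : expAd K x * expAd K (-x) = 1 := by
    have := IsNilpotent.exp_mul_exp_neg_self hx
    rwa [← map_neg] at this
  exact LinearMap.congr_fun h v

lemma map_expAd_apply (φ : L ≃ₗ⁅K⁆ L) {x : L} (hx : IsNilpotent (ad K L x)) (v : L) :
    φ (expAd K x v) = expAd K (φ x) (φ v) := by
  have key (i : ℕ) (u : L) : (ad K L (φ x) ^ i) (φ u) = φ ((ad K L x ^ i) u) := by
    induction i with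
    | zero => simp
    | succ i ih => rw [pow_succ', pow_succ', Module.End.mul_apply, Module.End.mul_apply, ih, ad_apply,
      ad_apply, LieEquiv.map_lie]
  obtain ⟨n, hn⟩ := hx
  have hn' : ad K L (φ x) ^ n = 0 := by
    ext u
    obtain ⟨u, rfl⟩ := φ.surjective u
    simp [key, hn]
  simp [expAd_eq_sum hn, expAd_eq_sum hn', key]

/-- The exponential of a nilpotent `ad x`, as an automorphism of the Lie algebra. -/
def expAdEquiv (x : L) (hx : IsNilpotent (ad K L x)) : L ≃ₗ⁅K⁆ L :=
  -- The rational structure is pulled back from K, so that this exponential agrees with `expAd`.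
  letI : LieAlgebra ℚ L :=
    { Module.compHom L (algebraMap ℚ K) with
      lie_smul := fun t x y ↦ lie_smul (algebraMap ℚ K t) x y }
  LieDerivation.exp (LieDerivation.ad K L x)
    (by rwa [LieDerivation.coe_ad_apply_eq_ad_apply])

lemma expAdEquiv_apply (x : L) (hx : IsNilpotent (ad K L x)) (v : L) :
    expAdEquiv x hx v = expAd K x v := by
  let : LieAlgebra ℚ L :=
    { Module.compHom L (algebraMap ℚ K) with
      lie_smul := fun t x y ↦ lie_smul (algebraMap ℚ K t) x y }
  refine (LieDerivation.exp_map_apply (LieDerivation.ad K L x) _ v).trans ?_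
  unfold expAd
  congr! 2
  exact LieDerivation.coe_ad_apply_eq_ad_apply x

lemma commute_expAd {x y : L} (hx : IsNilpotent (ad K L x)) (hy : IsNilpotent (ad K L y))
    (h : ⁅x, y⁆ = 0) : Commute (expAd K x) (expAd K y) := by
  have hc : Commute (ad K L x) (ad K L y) := by
    ext v
    simp [leibniz_lie x y, h]
  obtain ⟨n, hn⟩ := hx
  obtain ⟨m, hm⟩ := hy
  rw [expAd_eq_sum hn, expAd_eq_sum hm]
  exact Commute.sum_left _ _ _ fun i _ ↦ Commute.sum_right _ _ _ fun j _ ↦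
    ((hc.pow_pow i j).smul_left _).smul_right _

end Exponential

variable {K L : Type*} [Field K] [CharZero K] [LieRing L] [LieAlgebra K L]
  [IsKilling K L] [FiniteDimensional K L]
  {H : LieSubalgebra K L} [H.IsCartanSubalgebra] [LieModule.IsTriangularizable K H L]

/-! ### Root spaces and lifts of simple reflections -/

lemma mem_rootSpace_of_forall_lie_eq {χ : H → K} {x : L} (h : ∀ y : H, ⁅(y : L), x⁆ = χ y • x) :
    x ∈ rootSpace H χ :=
  LieModule.weightSpace_le_genWeightSpace L χ ((LieModule.mem_weightSpace χ x).mpr h)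

lemma eq_zero_of_mem_rootSpace {χ : Module.Dual K H} (h₀ : χ ≠ 0)
    (h : χ ∉ Set.range (rootSystem H).root) {x : L} (hx : x ∈ rootSpace H χ) : x = 0 := by
  by_contra hne
  refine h ⟨⟨⟨χ, fun hbot ↦ hne (by simpa [hbot] using hx)⟩, ?_⟩, ?_⟩
  · simp only [LieSubalgebra.root, Finset.mem_filter, Finset.mem_univ, true_and]
    exact fun h' ↦ h₀ (DFunLike.coe_injective h')
  · rfl

lemma exists_eq_smul_of_mem_rootSpace {β : H.root} {x y : L} (hx : x ∈ rootSpace H β.1)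
    (hx₀ : x ≠ 0) (hy : y ∈ rootSpace H β.1) : ∃ c : K, y = c • x := by
  obtain ⟨c, hc⟩ := (finrank_eq_one_iff_of_nonzero' (⟨x, hx⟩ : rootSpace H β.1)
    (by simpa [LieSubmodule.mk_eq_zero] using hx₀)).mp
    (finrank_rootSpace_eq_one β.1 (LieSubalgebra.isNonZero_coe_root β)) ⟨y, hy⟩
  exact ⟨c, by simpa using (congr_arg Subtype.val hc).symm⟩

lemma algebraMap_pairingIn_eq (β α : H.root) :
    (((rootSystem H).pairingIn ℤ β α : ℤ) : K) = β.1 (coroot α.1) := by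
  rw [← rootSystem_pairing_apply]
  exact (rootSystem H).algebraMap_pairingIn ℤ β α

lemma reflectionPerm_apply (α β : H.root) (y : H) :
    ((rootSystem H).reflectionPerm α β).1 y = β.1 y - β.1 (coroot α.1) * α.1 y := by
  exact (LinearMap.congr_fun ((rootSystem H).reflectionPerm_root α β) y).symm

lemma root_negRoot (γ : H.root) :
    (rootSystem H).root (negRoot γ) = -(rootSystem H).root γ := by
  ext y
  simp [negRoot]

lemma negRoot_eq_reflectionPerm (γ : H.root) :
    negRoot γ = (rootSystem H).reflectionPerm γ γ := by
  rw [← (rootSystem H).root_eq_neg_iff, root_negRoot]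

namespace Frame

variable {b : (rootSystem H).Base} (E : Frame b) (α : b.support)

lemma isNilpotent_ad_e : IsNilpotent (ad K L (E.e α)) := by
  refine isNilpotent_ad_of_mem_rootSpace H (fun h ↦ ?_) (E.e_mem α)
  exact LieSubalgebra.isNonZero_coe_root (α : H.root) h

lemma isNilpotent_ad_e' : IsNilpotent (ad K L (E.e' α)) := by
  refine isNilpotent_ad_of_mem_rootSpace H (fun h ↦ ?_) (E.e'_mem α)
  exact LieSubalgebra.isNonZero_coe_root (α : H.root) (neg_eq_zero.mp h)

lemma lie_coe_e (y : H) : ⁅(y : L), E.e α⁆ = (α : H.root).1 y • E.e α :=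
  lie_eq_smul_of_mem_rootSpace (E.e_mem α) y

lemma lie_coe_e' (y : H) : ⁅(y : L), E.e' α⁆ = -(α : H.root).1 y • E.e' α :=
  lie_eq_smul_of_mem_rootSpace (E.e'_mem α) y

lemma lie_e_coe (y : H) : ⁅E.e α, (y : L)⁆ = -(α : H.root).1 y • E.e α := by
  rw [← lie_skew, lie_coe_e, neg_smul]

lemma lie_e'_coe (y : H) : ⁅E.e' α, (y : L)⁆ = (α : H.root).1 y • E.e' α := by
  rw [← lie_skew, lie_coe_e', neg_smul, neg_neg]

lemma root_coroot_self : (α : H.root).1 (coroot (α : H.root).1) = 2 :=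
  root_apply_coroot (LieSubalgebra.isNonZero_coe_root (α : H.root))

lemma lie_e'_e : ⁅E.e' α, E.e α⁆ = (coroot (α : H.root).1 : L) := by
  rw [← lie_skew, E.lie_e_e', neg_neg]

lemma isSl2Triple : IsSl2Triple (coroot (α : H.root).1 : L) (E.e α) (-E.e' α) where
  h_ne_zero h := by
    have : coroot (α : H.root).1 = 0 := Subtype.ext h
    exact LieSubalgebra.isNonZero_coe_root (α : H.root) (coroot_eq_zero_iff.mp this)
  lie_e_f := by rw [lie_neg, E.lie_e_e', neg_neg]
  lie_h_e_nsmul := by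
    rw [E.lie_coe_e, root_coroot_self, two_smul, two_smul]
  lie_h_f_nsmul := by
    rw [lie_neg, E.lie_coe_e', root_coroot_self, neg_smul, neg_neg, two_smul, smul_neg, neg_neg,
      two_smul]

lemma e_ne_zero : E.e α ≠ 0 := (E.isSl2Triple α).e_ne_zero

lemma e'_ne_zero : E.e' α ≠ 0 := neg_ne_zero.mp (E.isSl2Triple α).f_ne_zero

/-- `simpleLift` as an automorphism of the Lie algebra. -/
def simpleLiftEquiv : L ≃ₗ⁅K⁆ L :=
  ((expAdEquiv (E.e α) (E.isNilpotent_ad_e α)).trans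
    (expAdEquiv (E.e' α) (E.isNilpotent_ad_e' α))).trans
    (expAdEquiv (E.e α) (E.isNilpotent_ad_e α))

lemma simpleLift_apply (v : L) :
    E.simpleLift α v = expAd K (E.e α) (expAd K (E.e' α) (expAd K (E.e α) v)) := rfl

lemma simpleLiftEquiv_apply (v : L) : E.simpleLiftEquiv α v = E.simpleLift α v := by
  simp [simpleLiftEquiv, simpleLift_apply, expAdEquiv_apply]

lemma simpleLift_lie (v w : L) :
    E.simpleLift α ⁅v, w⁆ = ⁅E.simpleLift α v, E.simpleLift α w⁆ := by
  simp only [← simpleLiftEquiv_apply]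
  exact LieEquiv.map_lie _ v w

lemma expAd_e_coe (y : H) : expAd K (E.e α) (y : L) = y - (α : H.root).1 y • E.e α := by
  rw [expAd_apply_of_lie_lie_eq_zero (E.isNilpotent_ad_e α) (by simp [lie_e_coe]), lie_e_coe,
    neg_smul, sub_eq_add_neg]

lemma expAd_e'_coe (y : H) : expAd K (E.e' α) (y : L) = y + (α : H.root).1 y • E.e' α := by
  rw [expAd_apply_of_lie_lie_eq_zero (E.isNilpotent_ad_e' α) (by simp [lie_e'_coe]), lie_e'_coe]

lemma expAd_e_e : expAd K (E.e α) (E.e α) = E.e α :=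
  expAd_apply_of_lie_eq_zero (E.isNilpotent_ad_e α) (lie_self _)

lemma expAd_e'_e' : expAd K (E.e' α) (E.e' α) = E.e' α :=
  expAd_apply_of_lie_eq_zero (E.isNilpotent_ad_e' α) (lie_self _)

lemma expAd_e_e' :
    expAd K (E.e α) (E.e' α) = E.e' α - (coroot (α : H.root).1 : L) + E.e α := by
  rw [expAd_apply_of_lie_lie_lie_eq_zero (E.isNilpotent_ad_e α)
    (by simp [E.lie_e_e', lie_e_coe]), E.lie_e_e', lie_neg, lie_e_coe, root_coroot_self,
    neg_smul, neg_neg, smul_smul, inv_mul_cancel₀ two_ne_zero, one_smul, sub_eq_add_neg]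

lemma expAd_e'_e :
    expAd K (E.e' α) (E.e α) = E.e α + (coroot (α : H.root).1 : L) + E.e' α := by
  rw [expAd_apply_of_lie_lie_lie_eq_zero (E.isNilpotent_ad_e' α)
    (by simp [E.lie_e'_e, lie_e'_coe]), E.lie_e'_e, lie_e'_coe, root_coroot_self,
    smul_smul, inv_mul_cancel₀ two_ne_zero, one_smul]

lemma simpleLift_e : E.simpleLift α (E.e α) = E.e' α := by
  simp only [simpleLift_apply, expAd_e_e, expAd_e'_e, map_add, expAd_e_e', expAd_e_coe,
    root_coroot_self]
  module

lemma simpleLift_e' : E.simpleLift α (E.e' α) = E.e α := by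
  simp only [simpleLift_apply, expAd_e_e', expAd_e'_e, expAd_e'_e', expAd_e_e, map_add, map_sub,
    expAd_e_coe, expAd_e'_coe, root_coroot_self, map_smul]
  module

lemma simpleLift_coe (y : H) :
    E.simpleLift α (y : L) = y - (α : H.root).1 y • (coroot (α : H.root).1 : L) := by
  simp only [simpleLift_apply, expAd_e_coe, map_sub, expAd_e'_coe, map_smul, expAd_e'_e, map_add,
    expAd_e_e', expAd_e_e, root_coroot_self]
  module

lemma simpleLift_mem {β : H.root} {x : L} (hx : x ∈ rootSpace H β.1) :
    E.simpleLift α x ∈ rootSpace H ((rootSystem H).reflectionPerm (α : H.root) β).1 := by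
  refine mem_rootSpace_of_forall_lie_eq fun y ↦ ?_
  -- The lift acts on H as s_α, so z = s_α y is the preimage of y.
  let z : H := y - (α : H.root).1 y • coroot (α : H.root).1
  have hz : E.simpleLift α (z : L) = y := by
    have hzc : (z : L) = y - (α : H.root).1 y • (coroot (α : H.root).1 : L) := rfl
    simp only [hzc, map_sub, map_smul, simpleLift_coe, root_coroot_self]
    module
  have hzx : ⁅(z : L), x⁆ = β.1 z • x := lie_eq_smul_of_mem_rootSpace hx z
  rw [← hz, ← simpleLift_lie, hzx, map_smul, reflectionPerm_apply]
  congr 1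
  simp only [z, ← LieModule.Weight.toLinear_apply, map_sub, map_smul, smul_eq_mul]
  ring

/-- The two symmetric expressions for the lift of a simple reflection agree. -/
lemma expAd_e'_expAd_e_expAd_e' (v : L) :
    expAd K (E.e' α) (expAd K (E.e α) (expAd K (E.e' α) v)) = E.simpleLift α v := by
  -- Write v = exp(ad e_α) u. The lift sends e_α to e_{-α}, so conjugation by it turns exp(ad e_α)
  -- into exp(ad e_{-α}).
  rw [← expAd_apply_expAd_neg_apply (E.isNilpotent_ad_e α) v]
  generalize expAd K (-E.e α) v = u
  have h := map_expAd_apply (E.simpleLiftEquiv α) (E.isNilpotent_ad_e α) u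
  simp only [simpleLiftEquiv_apply, simpleLift_e] at h
  rw [h, simpleLift_apply]

lemma map_simpleLift {θ : L ≃ₗ⁅K⁆ L} (hθ : E.IsChevalleyInvolution θ) (v : L) :
    θ (E.simpleLift α v) = E.simpleLift α (θ v) := by
  rw [← E.expAd_e'_expAd_e_expAd_e' α (θ v), simpleLift_apply,
    map_expAd_apply θ (E.isNilpotent_ad_e α), map_expAd_apply θ (E.isNilpotent_ad_e' α),
    map_expAd_apply θ (E.isNilpotent_ad_e α), hθ.map_e, hθ.map_e']

end Frame

/-! ### Action of a simple lift on a root string -/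

namespace Frame

variable {b : (rootSystem H).Base} (E : Frame b) (α : b.support)

/-- The divided powers of `ad e_{-α}` applied to a vector. -/
def divPow (v : L) (k : ℕ) : L := (k.factorial : K)⁻¹ • (ad K L (E.e' α) ^ k) v

lemma divPow_zero (v : L) : E.divPow α v 0 = v := by simp [divPow]

lemma ad_e'_pow (k : ℕ) (v : L) :
    (ad K L (E.e' α) ^ k) v = (-1 : K) ^ k • (LieModule.toEnd K L L (-E.e' α) ^ k) v := by
  have : LieModule.toEnd K L L (-E.e' α) = -ad K L (E.e' α) := by rw [map_neg]; rfl
  rw [this, neg_pow (ad K L (E.e' α)), Module.End.mul_apply]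
  rcases Nat.even_or_odd k with h | h <;> simp [h.neg_one_pow]

variable {E α} {v : L} {m : ℕ}
  (hv : (E.isSl2Triple α).HasPrimitiveVectorWith v (m : K))

include hv

/-- The usual sl₂ relation with the sign reversed, since f = -e_{-α}. -/
lemma lie_e_divPow_succ (k : ℕ) :
    ⁅E.e α, E.divPow α v (k + 1)⁆ = ((k : K) - m) • E.divPow α v k := by
  have hk : ((k : K) + 1) ≠ 0 := by exact_mod_cast k.succ_ne_zero
  have hk' : (k.factorial : K) ≠ 0 := by exact_mod_cast k.factorial_ne_zero
  simp only [divPow, ad_e'_pow, lie_smul, hv.lie_e_pow_succ_toEnd_f, smul_smul,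
    Nat.factorial_succ, Nat.cast_mul, Nat.cast_add, Nat.cast_one]
  congr 1
  field_simp
  ring

lemma divPow_ne_zero {k : ℕ} (hk : k ≤ m) : E.divPow α v k ≠ 0 := by
  have := hv.pow_toEnd_f_ne_zero_of_eq_nat rfl hk
  rw [divPow, ad_e'_pow]
  simpa [Nat.factorial_ne_zero] using this

lemma ad_e_pow_divPow {j : ℕ} (hj : j ≤ m) :
    (ad K L (E.e α) ^ j) (E.divPow α v m) =
      ((-1) ^ j * (j.factorial : K)) • E.divPow α v (m - j) := by
  induction j with
  | zero => simp
  | succ j ih =>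
    obtain ⟨k, rfl⟩ := Nat.exists_eq_add_of_le' hj
    have h₁ : k + (j + 1) - j = k + 1 := by omega
    rw [pow_succ', Module.End.mul_apply, ih (by omega), h₁, Nat.add_sub_cancel, map_smul, ad_apply,
      lie_e_divPow_succ hv, smul_smul, Nat.factorial_succ]
    congr 1
    push_cast
    ring

lemma ad_neg_e_pow_divPow {j : ℕ} (hj : j ≤ m) :
    (ad K L (-E.e α) ^ j) (E.divPow α v m) = (j.factorial : K) • E.divPow α v (m - j) := by
  rw [map_neg, neg_pow, Module.End.mul_apply, ad_e_pow_divPow hv hj]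
  rcases Nat.even_or_odd j with h | h <;> simp [h.neg_one_pow]

lemma ad_neg_e_pow_succ_divPow : (ad K L (-E.e α) ^ (m + 1)) (E.divPow α v m) = 0 := by
  rw [pow_succ', Module.End.mul_apply, ad_neg_e_pow_divPow hv le_rfl]
  simp [divPow_zero, hv.lie_e]

/-- The sum of all divided powers is both exp(ad e_{-α}) v and exp(-ad e_α) of the lowest vector;
the outer exp(ad e_α) cancels the latter. -/
lemma simpleLift_of_primitive : E.simpleLift α v = E.divPow α v m := by
  have hneg : IsNilpotent (ad K L (-E.e α)) := by
    rw [map_neg]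
    exact (E.isNilpotent_ad_e α).neg
  have h₁ : expAd K (E.e' α) v = ∑ j ∈ Finset.range (m + 1), E.divPow α v j := by
    have h := hv.pow_toEnd_f_eq_zero_of_eq_nat rfl
    exact expAd_apply (E.isNilpotent_ad_e' α) (by rw [ad_e'_pow, h, smul_zero])
  have h₂ : expAd K (-E.e α) (E.divPow α v m) = ∑ j ∈ Finset.range (m + 1), E.divPow α v j := by
    rw [expAd_apply hneg (ad_neg_e_pow_succ_divPow hv), ← Finset.sum_range_reflect]
    refine Finset.sum_congr rfl fun j hj ↦ ?_
    have hj : j ≤ m := by simpa [Nat.lt_succ_iff] using hj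
    have hj' : m + 1 - 1 - j ≤ m := by omega
    have hj'' : m - (m + 1 - 1 - j) = j := by omega
    rw [ad_neg_e_pow_divPow hv hj', smul_smul, inv_mul_cancel₀
      (by exact_mod_cast Nat.factorial_ne_zero _), one_smul, hj'']
  rw [simpleLift_apply, expAd_apply_of_lie_eq_zero (E.isNilpotent_ad_e α) hv.lie_e, h₁, ← h₂,
    expAd_apply_expAd_neg_apply (E.isNilpotent_ad_e α)]

/-- The lift intertwines ad e_{-α} with ad e_α, so the claim reduces to the primitive vector. -/
lemma simpleLift_divPow {k : ℕ} (hk : k ≤ m) :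
    E.simpleLift α (E.divPow α v k) = (-1 : K) ^ k • E.divPow α v (m - k) := by
  have key (j : ℕ) (u : L) : E.simpleLift α ((ad K L (E.e' α) ^ j) u) =
      (ad K L (E.e α) ^ j) (E.simpleLift α u) := by
    induction j with
    | zero => simp
    | succ j ih =>
      rw [pow_succ', pow_succ', Module.End.mul_apply, Module.End.mul_apply, ad_apply, ad_apply,
        simpleLift_lie, simpleLift_e', ih]
  have hk' : (k.factorial : K) ≠ 0 := by exact_mod_cast k.factorial_ne_zero
  rw [divPow, map_smul, key, simpleLift_of_primitive hv, ad_e_pow_divPow hv hk, smul_smul]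
  congr 1
  field_simp

lemma simpleLift_simpleLift_divPow {k : ℕ} (hk : k ≤ m) :
    E.simpleLift α (E.simpleLift α (E.divPow α v k)) = (-1 : K) ^ m • E.divPow α v k := by
  have h : m - (m - k) = k := by omega
  rw [simpleLift_divPow hv hk, map_smul, simpleLift_divPow hv (Nat.sub_le m k), smul_smul,
    ← pow_add, h, Nat.add_sub_cancel' hk]

omit hv

/-- The vector v is taken at the top of the α-string through β; descending to β spans the line
containing x. -/
lemma exists_primitive {β : H.root} (h : LinearIndependent K
      ![(rootSystem H).root (α : H.root), (rootSystem H).root β])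
    {x : L} (hx : x ∈ rootSpace H β.1) :
    ∃ v : L, (E.isSl2Triple α).HasPrimitiveVectorWith v
        (((rootSystem H).chainBotCoeff (α : H.root) β +
          (rootSystem H).chainTopCoeff (α : H.root) β : ℕ) : K) ∧
      ∃ c : K, x = c • E.divPow α v ((rootSystem H).chainTopCoeff (α : H.root) β) := by
  set P := rootSystem H
  set q := P.chainTopCoeff (α : H.root) β
  set t := P.chainTopIdx (α : H.root) β
  have hroot : P.root t = P.root β + q • P.root (α : H.root) := P.root_chainTopIdx
  have ht : LinearIndependent K ![P.root (α : H.root), P.root t] := by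
    rwa [hroot, add_comm, ← natCast_zsmul, LinearIndependent.pair_add_smul_right_iff]
  obtain ⟨v, hvt, hv₀⟩ := t.1.exists_ne_zero
  have hv : (E.isSl2Triple α).HasPrimitiveVectorWith v
      ((P.chainBotCoeff (α : H.root) β + q : ℕ) : K) := by
    refine ⟨hv₀, ?_, ?_⟩
    · have h₁ : ⁅(coroot (α : H.root).1 : L), v⁆ = t.1 (coroot (α : H.root).1) • v :=
        lie_eq_smul_of_mem_rootSpace hvt _
      rw [h₁, ← algebraMap_pairingIn_eq,
        ← P.chainBotCoeff_add_chainTopCoeff_eq_pairingIn_chainTopIdx h]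
      push_cast
      rfl
    · have h₁ := P.chainTopCoeff_chainTopIdx (i := (α : H.root)) (j := β)
      rw [P.chainTopCoeff_eq_zero_iff] at h₁
      refine eq_zero_of_mem_rootSpace (fun h₀ ↦ ?_) (h₁.resolve_left (not_not.mpr ht)) ?_
      · have := LinearIndependent.pair_iff.mp ht 1 1 (by rw [one_smul, one_smul, add_comm]; exact h₀)
        simp at this
      · rw [add_comm]
        exact lie_mem_genWeightSpace_of_mem_genWeightSpace (E.e_mem α) hvt
  refine ⟨v, hv, exists_eq_smul_of_mem_rootSpace ?_ (divPow_ne_zero hv (by omega)) hx⟩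
  have h₁ := toEnd_pow_apply_mem (E.e'_mem α) hvt q
  have h₂ : q • (-(α : H.root).1 : H → K) + t.1 = β.1 := by
    ext y
    have := LinearMap.congr_fun hroot y
    replace this : t.1 y = β.1 y + q • (α : H.root).1 y := this
    simp [this]
  rw [h₂] at h₁
  exact Submodule.smul_mem _ _ h₁

/-- The string length p + q has the parity of the pairing p - q. -/
lemma simpleLift_simpleLift {β : H.root} {x : L} (hx : x ∈ rootSpace H β.1) :
    E.simpleLift α (E.simpleLift α x) =
      (-1 : K) ^ ((rootSystem H).pairingIn ℤ β (α : H.root)) • x := by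
  by_cases h : LinearIndependent K
    ![(rootSystem H).root (α : H.root), (rootSystem H).root β]
  · obtain ⟨v, hv, c, rfl⟩ := E.exists_primitive h hx
    rw [map_smul, map_smul, simpleLift_simpleLift_divPow hv (by omega), smul_comm,
      ← (rootSystem H).chainBotCoeff_sub_chainTopCoeff h, zpow_sub₀ (by simp), pow_add]
    simp [div_eq_mul_inv, ← inv_pow, inv_neg]
  · rcases RootPairing.IsReduced.eq_or_eq_neg _ _ h with h | h
    · obtain rfl : (α : H.root) = β := (rootSystem H).root.injective h
      obtain ⟨c, rfl⟩ := exists_eq_smul_of_mem_rootSpace (E.e_mem α) (E.e_ne_zero α) hx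
      simp [simpleLift_e, simpleLift_e']
    · rw [← root_negRoot, EmbeddingLike.apply_eq_iff_eq] at h
      obtain rfl : β = negRoot (α : H.root) := by
        rw [h]
        ext y
        simp [negRoot]
      obtain ⟨c, rfl⟩ := exists_eq_smul_of_mem_rootSpace (β := negRoot (α : H.root))
        (E.e'_mem α) (E.e'_ne_zero α) hx
      simp [simpleLift_e, simpleLift_e', negRoot_eq_reflectionPerm]

/-- Here x sits in the middle of its string, which the lift reverses. -/
lemma simpleLift_of_pairingIn_eq_zero {β : H.root} {x : L} (hx : x ∈ rootSpace H β.1)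
    (h₀ : (rootSystem H).pairingIn ℤ β (α : H.root) = 0) :
    E.simpleLift α x = (-1 : K) ^ (rootSystem H).chainBotCoeff (α : H.root) β • x := by
  have h : LinearIndependent K ![(rootSystem H).root (α : H.root), (rootSystem H).root β] := by
    by_contra h
    rcases RootPairing.IsReduced.eq_or_eq_neg _ _ h with h | h
    · obtain rfl : (α : H.root) = β := (rootSystem H).root.injective h
      simp at h₀
    · rw [← root_negRoot, EmbeddingLike.apply_eq_iff_eq, negRoot_eq_reflectionPerm] at h
      have := (rootSystem H).pairingIn_reflectionPerm_self_left ℤ (i := β) (j := α)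
      rw [← h] at this
      simp [h₀] at this
  obtain ⟨v, hv, c, rfl⟩ := E.exists_primitive h hx
  have hq := (rootSystem H).chainBotCoeff_sub_chainTopCoeff h
  rw [h₀, sub_eq_zero, Nat.cast_inj] at hq
  rw [map_smul, simpleLift_divPow hv (by omega), smul_comm, hq, Nat.add_sub_cancel]

end Frame

/-! ### Commutation and the A₂ braid relation -/

lemma lie_eq_zero_of_add_notMem_range_root {χ ψ : Module.Dual K H} (h₀ : χ + ψ ≠ 0)
    (h : χ + ψ ∉ Set.range (rootSystem H).root) {x y : L} (hx : x ∈ rootSpace H χ)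
    (hy : y ∈ rootSpace H ψ) : ⁅x, y⁆ = 0 :=
  eq_zero_of_mem_rootSpace h₀ h (lie_mem_genWeightSpace_of_mem_genWeightSpace hx hy)

lemma reflection_root_eq_sub (α β : H.root) :
    (rootSystem H).reflection α ((rootSystem H).root β) = (rootSystem H).root β -
      (rootSystem H).pairingIn ℤ β α • (rootSystem H).root α :=
  (rootSystem H).reflection_apply_root' ℤ

lemma neg_notMem_range_root {χ : Module.Dual K H} (h : χ ∉ Set.range (rootSystem H).root) :
    -χ ∉ Set.range (rootSystem H).root := by
  rwa [(rootSystem H).neg_mem_range_root_iff]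

lemma notMem_range_root_of_reflection (α : H.root) {χ : Module.Dual K H}
    (h : (rootSystem H).reflection α χ ∉ Set.range (rootSystem H).root) :
    χ ∉ Set.range (rootSystem H).root := by
  rintro ⟨k, rfl⟩
  exact h ⟨_, (rootSystem H).root_reflectionPerm α k⟩

/-- Reflection in α_j turns the sum into a difference of simple roots, which is never a root. -/
lemma root_add_root_notMem_range {b : (rootSystem H).Base} {i j : b.support}
    (h : (rootSystem H).pairingIn ℤ (i : H.root) (j : H.root) = 0) :
    (rootSystem H).root i + (rootSystem H).root j ∉ Set.range (rootSystem H).root := by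
  refine notMem_range_root_of_reflection (j : H.root) ?_
  rw [map_add, reflection_root_eq_sub, RootPairing.reflection_apply_self, h, zero_smul, sub_zero,
    ← sub_eq_add_neg]
  exact b.sub_notMem_range_root i.2 j.2

lemma root_add_root_add_root_notMem_range {b : (rootSystem H).Base} {i j : b.support}
    (h : (rootSystem H).pairingIn ℤ (j : H.root) (i : H.root) = -1) :
    (rootSystem H).root i + ((rootSystem H).root i + (rootSystem H).root j) ∉
      Set.range (rootSystem H).root := by
  refine notMem_range_root_of_reflection (i : H.root) ?_
  rw [map_add, map_add, reflection_root_eq_sub _ (j : H.root), RootPairing.reflection_apply_self, h]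
  have := b.sub_notMem_range_root j.2 i.2
  convert this using 2
  module

namespace Frame

variable {b : (rootSystem H).Base} (E : Frame b) {i j : b.support}

lemma root_add_root_ne_zero (hij : i ≠ j) :
    (rootSystem H).root i + (rootSystem H).root j ≠ 0 := fun h ↦
  b.root_ne_neg_of_ne i.2 j.2 (Subtype.coe_injective.ne hij) (eq_neg_of_add_eq_zero_left h)

lemma root_sub_root_ne_zero (hij : i ≠ j) :
    (rootSystem H).root i - (rootSystem H).root j ≠ 0 := fun h ↦
  hij (Subtype.ext ((rootSystem H).root.injective (sub_eq_zero.mp h)))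

lemma lie_e_e'_of_ne (hij : i ≠ j) : ⁅E.e i, E.e' j⁆ = 0 := by
  refine lie_eq_zero_of_add_notMem_range_root (χ := (rootSystem H).root i)
    (ψ := -(rootSystem H).root j) ?_ ?_ (E.e_mem i) (E.e'_mem j)
  · rw [← sub_eq_add_neg]
    exact root_sub_root_ne_zero hij
  · rw [← sub_eq_add_neg]
    exact b.sub_notMem_range_root i.2 j.2

lemma lie_e'_e_of_ne (hij : i ≠ j) : ⁅E.e' i, E.e j⁆ = 0 := by
  rw [← lie_skew, E.lie_e_e'_of_ne hij.symm, neg_zero]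

lemma lie_e_e_of_pairingIn_eq_zero (hij : i ≠ j)
    (h : (rootSystem H).pairingIn ℤ (i : H.root) (j : H.root) = 0) : ⁅E.e i, E.e j⁆ = 0 :=
  lie_eq_zero_of_add_notMem_range_root (root_add_root_ne_zero hij) (root_add_root_notMem_range h)
    (E.e_mem i) (E.e_mem j)

lemma lie_e'_e'_of_pairingIn_eq_zero (hij : i ≠ j)
    (h : (rootSystem H).pairingIn ℤ (i : H.root) (j : H.root) = 0) : ⁅E.e' i, E.e' j⁆ = 0 := by
  refine lie_eq_zero_of_add_notMem_range_root (χ := -(rootSystem H).root i)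
    (ψ := -(rootSystem H).root j) ?_ ?_ (E.e'_mem i) (E.e'_mem j)
  · rw [← neg_add]
    exact neg_ne_zero.mpr (root_add_root_ne_zero hij)
  · rw [← neg_add]
    exact neg_notMem_range_root (root_add_root_notMem_range h)

lemma commute_simpleLift (hij : i ≠ j)
    (h : (rootSystem H).pairingIn ℤ (i : H.root) (j : H.root) = 0) :
    Commute (E.simpleLift i) (E.simpleLift j) := by
  have h₁ := commute_expAd (E.isNilpotent_ad_e i) (E.isNilpotent_ad_e j)
    (E.lie_e_e_of_pairingIn_eq_zero hij h)
  have h₂ := commute_expAd (E.isNilpotent_ad_e i) (E.isNilpotent_ad_e' j) (E.lie_e_e'_of_ne hij)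
  have h₃ := commute_expAd (E.isNilpotent_ad_e' i) (E.isNilpotent_ad_e j) (E.lie_e'_e_of_ne hij)
  have h₄ := commute_expAd (E.isNilpotent_ad_e' i) (E.isNilpotent_ad_e' j)
    (E.lie_e'_e'_of_pairingIn_eq_zero hij h)
  have h₅ := (h₁.mul_right h₂).mul_right h₁
  have h₆ := (h₃.mul_right h₄).mul_right h₃
  exact (h₅.mul_left h₆).mul_left h₅

lemma ne_of_pairingIn_eq_neg_one
    (h : (rootSystem H).pairingIn ℤ (j : H.root) (i : H.root) = -1) : i ≠ j := by
  rintro rfl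
  simp at h

lemma lie_coroot_e_of_pairingIn_eq_neg_one
    (h : (rootSystem H).pairingIn ℤ (j : H.root) (i : H.root) = -1) :
    ⁅(coroot (i : H.root).1 : L), E.e j⁆ = -E.e j := by
  rw [E.lie_coe_e, ← algebraMap_pairingIn_eq, h]
  simp

lemma hasPrimitiveVectorWith_e'
    (h : (rootSystem H).pairingIn ℤ (j : H.root) (i : H.root) = -1) :
    (E.isSl2Triple i).HasPrimitiveVectorWith (E.e' j) ((1 : ℕ) : K) where
  ne_zero := E.e'_ne_zero j
  lie_h := by
    rw [E.lie_coe_e', ← algebraMap_pairingIn_eq, h]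
    simp
  lie_e := E.lie_e_e'_of_ne (ne_of_pairingIn_eq_neg_one h)

lemma hasPrimitiveVectorWith_lie_e_e
    (h : (rootSystem H).pairingIn ℤ (j : H.root) (i : H.root) = -1) :
    (E.isSl2Triple i).HasPrimitiveVectorWith ⁅E.e i, E.e j⁆ ((1 : ℕ) : K) where
  ne_zero h₀ := by
    have h₁ := congr_arg (⁅E.e' i, ·⁆) h₀
    simp only [leibniz_lie (E.e' i), E.lie_e'_e, E.lie_e'_e_of_ne (ne_of_pairingIn_eq_neg_one h),
      E.lie_coroot_e_of_pairingIn_eq_neg_one h, lie_zero, add_zero, neg_eq_zero] at h₁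
    exact E.e_ne_zero j h₁
  lie_h := by
    rw [leibniz_lie, E.lie_coroot_e_of_pairingIn_eq_neg_one h, E.lie_coe_e, root_coroot_self,
      lie_neg, smul_lie, Nat.cast_one]
    module
  lie_e := by
    refine lie_eq_zero_of_add_notMem_range_root (χ := (rootSystem H).root i)
      (ψ := (rootSystem H).root i + (rootSystem H).root j) (fun h₀ ↦ ?_)
      (root_add_root_add_root_notMem_range h) (E.e_mem i)
      (lie_mem_genWeightSpace_of_mem_genWeightSpace (E.e_mem i) (E.e_mem j))
    have hli := b.linearIndependent_pair_of_ne (ne_of_pairingIn_eq_neg_one h)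
    have := LinearIndependent.pair_iff.mp hli 2 1
      (by rw [two_smul, one_smul, add_assoc]; exact h₀)
    simp at this

lemma simpleLift_lie_e'_e'
    (h : (rootSystem H).pairingIn ℤ (j : H.root) (i : H.root) = -1) :
    E.simpleLift i ⁅E.e' i, E.e' j⁆ = -E.e' j := by
  simpa [divPow] using simpleLift_divPow (E.hasPrimitiveVectorWith_e' h) le_rfl

lemma simpleLift_e_of_pairingIn_eq_neg_one
    (h : (rootSystem H).pairingIn ℤ (j : H.root) (i : H.root) = -1) :
    E.simpleLift i (E.e j) = ⁅E.e i, E.e j⁆ := by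
  have := simpleLift_divPow (E.hasPrimitiveVectorWith_lie_e_e h) le_rfl
  simpa [-lie_skew, divPow, leibniz_lie (E.e' i), E.lie_e'_e,
    E.lie_e'_e_of_ne (ne_of_pairingIn_eq_neg_one h),
    E.lie_coroot_e_of_pairingIn_eq_neg_one h] using this

/-- The braid relation of type `A₂` on the lowest root space. -/
lemma simpleLift_braid {γ : H.root}
    (hγ : (rootSystem H).root γ + (rootSystem H).root i + (rootSystem H).root j = 0)
    (hij : (rootSystem H).pairingIn ℤ (i : H.root) (j : H.root) = -1)
    (hji : (rootSystem H).pairingIn ℤ (j : H.root) (i : H.root) = -1)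
    {x : L} (hx : x ∈ rootSpace H γ.1) :
    E.simpleLift i (E.simpleLift j (E.simpleLift i x)) =
      E.simpleLift j (E.simpleLift i (E.simpleLift j x)) := by
  -- This bracket spans the root space, and both sides send it to -[e_i, e_j].
  have hne : ⁅E.e' i, E.e' j⁆ ≠ 0 := by
    simpa [divPow] using divPow_ne_zero (E.hasPrimitiveVectorWith_e' hji) le_rfl
  have hmem : ⁅E.e' i, E.e' j⁆ ∈ rootSpace H γ.1 := by
    have h₁ := lie_mem_genWeightSpace_of_mem_genWeightSpace (E.e'_mem i) (E.e'_mem j)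
    have h₂ : (-(i : H.root).1 + -(j : H.root).1 : H → K) = γ.1 := by
      ext y
      have : γ.1 y + (i : H.root).1 y + (j : H.root).1 y = 0 := LinearMap.congr_fun hγ y
      simp only [Pi.add_apply, Pi.neg_apply]
      linear_combination -this
    rwa [h₂] at h₁
  obtain ⟨c, rfl⟩ := exists_eq_smul_of_mem_rootSpace hmem hne hx
  simp only [map_smul]
  congr 1
  have h : E.simpleLift j ⁅E.e' i, E.e' j⁆ = E.e' i := by
    rw [← lie_skew, map_neg, E.simpleLift_lie_e'_e' hij, neg_neg]
  rw [E.simpleLift_lie_e'_e' hji, map_neg, map_neg, simpleLift_e', h, simpleLift_e',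
    E.simpleLift_e_of_pairingIn_eq_neg_one hij, E.simpleLift_e_of_pairingIn_eq_neg_one hji,
    lie_skew]

end Frame

/-! ### Parity of ⟪β, γ⟫ and the height measure -/

lemma term_of_pairingIn_neg {β γ : H.root} (h : (rootSystem H).pairingIn ℤ β γ < 0) :
    term (rootSystem H) β γ = 0 := by
  rw [term, if_neg (by omega), if_neg (by omega)]

lemma neg_one_pow_term_of_pairingIn_pos {β γ : H.root}
    (h : 0 < (rootSystem H).pairingIn ℤ β γ) :
    (-1 : K) ^ term (rootSystem H) β γ = (-1 : K) ^ (rootSystem H).pairingIn ℤ β γ := by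
  rw [term, if_pos h, ← zpow_natCast, Int.toNat_of_nonneg h.le]

lemma pairingIn_negRoot (β γ : H.root) :
    (rootSystem H).pairingIn ℤ (negRoot β) γ = -(rootSystem H).pairingIn ℤ β γ := by
  rw [negRoot_eq_reflectionPerm, RootPairing.pairingIn_reflectionPerm_self_left]

/-- The parity of `⟪β, γ⟫ - ⟪-β, γ⟫` is that of the pairing of `β` and `γ`. -/
lemma neg_one_pow_term_negRoot (β γ : H.root) :
    (-1 : K) ^ term (rootSystem H) (negRoot β) γ =
      (-1 : K) ^ (rootSystem H).pairingIn ℤ β γ * (-1 : K) ^ term (rootSystem H) β γ := by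
  have hsq (n : ℤ) : (-1 : K) ^ n * (-1 : K) ^ n = 1 := by
    rw [← mul_zpow, neg_one_mul, neg_neg, one_zpow]
  rcases lt_trichotomy ((rootSystem H).pairingIn ℤ β γ) 0 with h | h | h
  · have h' : 0 < (rootSystem H).pairingIn ℤ (negRoot β) γ := by
      rw [pairingIn_negRoot]; omega
    rw [neg_one_pow_term_of_pairingIn_pos h', term_of_pairingIn_neg h, pairingIn_negRoot,
      zpow_neg, ← inv_zpow, inv_neg_one, pow_zero, mul_one]
  · have h' : (rootSystem H).pairingIn ℤ (negRoot β) γ = 0 := by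
      rw [pairingIn_negRoot, h, neg_zero]
    -- Negating β exchanges the two arms of its γ-string, which are equal when the pairing vanishes.
    have hli : term (rootSystem H) (negRoot β) γ = term (rootSystem H) β γ := by
      rw [term, if_neg (by omega), if_pos h', term, if_neg (by omega), if_pos h,
        negRoot_eq_reflectionPerm, RootPairing.chainBotCoeff_reflectionPerm_right]
      by_cases hl : LinearIndependent K ![(rootSystem H).root γ, (rootSystem H).root β]
      · have := (rootSystem H).chainBotCoeff_sub_chainTopCoeff hl
        omega
      · rw [RootPairing.chainBotCoeff_of_not_linearIndependent hl,
          RootPairing.chainTopCoeff_of_not_linearIndependent hl]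
    rw [hli, h, zpow_zero, one_mul]
  · have h' : (rootSystem H).pairingIn ℤ (negRoot β) γ < 0 := by
      rw [pairingIn_negRoot]; omega
    rw [neg_one_pow_term_of_pairingIn_pos h, term_of_pairingIn_neg h', hsq, pow_zero]

lemma pairingIn_reflectionPerm_self (α β : H.root) :
    (rootSystem H).pairingIn ℤ ((rootSystem H).reflectionPerm α β) α =
      -(rootSystem H).pairingIn ℤ β α := by
  rw [← RootPairing.pairingIn_reflectionPerm, RootPairing.pairingIn_reflectionPerm_self_right]

/-- The number of roots of greater height. -/
def numAbove (b : (rootSystem H).Base) (γ : H.root) : ℕ :=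
  {δ : H.root | b.height γ < b.height δ}.ncard

lemma numAbove_reflectionPerm_lt (b : (rootSystem H).Base) {i : b.support} {γ : H.root}
    (h : (rootSystem H).pairingIn ℤ γ (i : H.root) < 0) :
    numAbove b ((rootSystem H).reflectionPerm (i : H.root) γ) < numAbove b γ := by
  have hh := height_reflectionPerm b i.2 γ
  refine Set.ncard_lt_ncard ⟨fun δ hδ ↦ ?_, fun hsub ↦ ?_⟩ (Set.toFinite _)
  · simp only [Set.mem_ofPred_eq] at hδ ⊢
    omega
  · have : (rootSystem H).reflectionPerm (i : H.root) γ ∈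
        {δ : H.root | b.height γ < b.height δ} := by
      simp only [Set.mem_ofPred_eq]
      omega
    simpa using hsub this

/-! ### Path independence of Kottwitz steps -/

namespace Frame

variable {b : (rootSystem H).Base} (E : Frame b)

/-- The Kottwitz lift of a simple reflection, on pairs of a root and a vector of its root space. -/
def step (i : b.support) (p : H.root × L) : H.root × L :=
  ((rootSystem H).reflectionPerm (i : H.root) p.1,
    (-1 : K) ^ term (rootSystem H) p.1 (i : H.root) • E.simpleLift i p.2)

variable {E} in
lemma step_mem (i : b.support) {p : H.root × L} (hp : p.2 ∈ rootSpace H p.1.1) :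
    (E.step i p).2 ∈ rootSpace H (E.step i p).1.1 :=
  Submodule.smul_mem _ _ (E.simpleLift_mem i hp)

variable {i j : b.support} {p : H.root × L}

lemma step_of_pairingIn_neg (h : (rootSystem H).pairingIn ℤ p.1 (i : H.root) < 0) :
    E.step i p = ((rootSystem H).reflectionPerm (i : H.root) p.1, E.simpleLift i p.2) := by
  rw [step, term_of_pairingIn_neg h, pow_zero, one_smul]

lemma step_of_pairingIn_eq_zero (hp : p.2 ∈ rootSpace H p.1.1)
    (h : (rootSystem H).pairingIn ℤ p.1 (i : H.root) = 0) : E.step i p = p := by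
  have h' : (rootSystem H).pairing p.1 (i : H.root) = 0 := by
    rw [← (rootSystem H).algebraMap_pairingIn ℤ, h, map_zero]
  refine Prod.ext ((rootSystem H).reflectionPerm_eq_of_pairing_eq_zero h') ?_
  simp only [step]
  rw [E.simpleLift_of_pairingIn_eq_zero hp h, smul_smul, term, if_neg (by omega), if_pos h,
    ← mul_pow, neg_one_mul, neg_neg, one_pow, one_smul]

/-- The squared lift is (-1)^⟨β,α^∨⟩. If the pairing is nonzero, exactly one of β and s_αβ pairs
positively with α, and its term cancels this sign. -/
lemma step_step (hp : p.2 ∈ rootSpace H p.1.1) : E.step i (E.step i p) = p := by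
  rcases eq_or_ne ((rootSystem H).pairingIn ℤ p.1 (i : H.root)) 0 with h | h
  · rw [E.step_of_pairingIn_eq_zero hp h, E.step_of_pairingIn_eq_zero hp h]
  refine Prod.ext ((rootSystem H).reflectionPerm_self _ _) ?_
  simp only [step]
  have hs := pairingIn_reflectionPerm_self (i : H.root) p.1
  have hsq (n : ℤ) : (-1 : K) ^ n * (-1 : K) ^ n = 1 := by
    rw [← mul_zpow, neg_one_mul, neg_neg, one_zpow]
  rw [map_smul, E.simpleLift_simpleLift hp, smul_smul, smul_smul]
  rcases lt_or_gt_of_ne h with h | h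
  · rw [term_of_pairingIn_neg h, neg_one_pow_term_of_pairingIn_pos (by rw [hs]; omega), hs,
      zpow_neg, ← inv_zpow, inv_neg_one, pow_zero, mul_one, hsq, one_smul]
  · rw [neg_one_pow_term_of_pairingIn_pos h, term_of_pairingIn_neg (by rw [hs]; omega),
      pow_zero, one_mul, hsq, one_smul]

open Classical in
/-- The result of raising a root as far as possible by simple reflections, and of transporting a
vector along. -/
def normalForm (p : H.root × L) : H.root × L :=
  if h : ∃ i : b.support, (rootSystem H).pairingIn ℤ p.1 (i : H.root) < 0 then
    normalForm (E.step h.choose p)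
  else p
termination_by numAbove b p.1
decreasing_by exact numAbove_reflectionPerm_lt b h.choose_spec

lemma normalForm_eq_self (h : ¬ ∃ i : b.support, (rootSystem H).pairingIn ℤ p.1 (i : H.root) < 0) :
    E.normalForm p = p := by
  rw [normalForm, dif_neg h]

lemma exists_normalForm_eq
    (h : ∃ i : b.support, (rootSystem H).pairingIn ℤ p.1 (i : H.root) < 0) :
    ∃ i : b.support, (rootSystem H).pairingIn ℤ p.1 (i : H.root) < 0 ∧
      E.normalForm p = E.normalForm (E.step i p) :=
  ⟨h.choose, h.choose_spec, by rw [normalForm, dif_pos h]⟩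

/-- Two ways of raising a root can be completed to a square, or to a hexagon. -/
lemma step_confluent (hp : p.2 ∈ rootSpace H p.1.1) (hij : i ≠ j)
    (hi : (rootSystem H).pairingIn ℤ p.1 (i : H.root) < 0)
    (hj : (rootSystem H).pairingIn ℤ p.1 (j : H.root) < 0) :
    ((rootSystem H).pairingIn ℤ (E.step i p).1 (j : H.root) < 0 ∧
      (rootSystem H).pairingIn ℤ (E.step j p).1 (i : H.root) < 0 ∧
      E.step j (E.step i p) = E.step i (E.step j p)) ∨
    ((rootSystem H).pairingIn ℤ (E.step i p).1 (j : H.root) < 0 ∧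
      (rootSystem H).pairingIn ℤ (E.step j (E.step i p)).1 (i : H.root) < 0 ∧
      (rootSystem H).pairingIn ℤ (E.step j p).1 (i : H.root) < 0 ∧
      (rootSystem H).pairingIn ℤ (E.step i (E.step j p)).1 (j : H.root) < 0 ∧
      E.step i (E.step j (E.step i p)) = E.step j (E.step i (E.step j p))) := by
  obtain ⟨γ, x⟩ := p
  dsimp only at hp hi hj
  have hle := b.pairingIn_le_zero_of_ne (Subtype.coe_injective.ne hij) i.2 j.2
  rcases hle.lt_or_eq with h | h
  · right
    have h' := ((rootSystem H).pairingIn_lt_zero_iff ℤ).mp h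
    have hi' := ((rootSystem H).pairingIn_lt_zero_iff ℤ).mp hi
    have hj' := ((rootSystem H).pairingIn_lt_zero_iff ℤ).mp hj
    have hij₁ := pairingIn_eq_neg_one_of_pairingIn_neg h hj' hi
    have hji₁ := pairingIn_eq_neg_one_of_pairingIn_neg h' hi' hj
    have hγi := pairingIn_eq_neg_one_of_pairingIn_neg hi h hj'
    have hγj := pairingIn_eq_neg_one_of_pairingIn_neg hj h' hi'
    -- Thus γ = -(α_i + α_j), and the two raising paths run through -α_j, α_j and through -α_i, α_i.
    have hsum := root_add_root_add_root_eq_zero_of_pairingIn_neg hi h hj'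
    have e₁ : (rootSystem H).reflectionPerm (i : H.root) γ = negRoot (j : H.root) := by
      apply (rootSystem H).root.injective
      rw [root_reflectionPerm_eq_sub, hγi, root_negRoot, neg_one_smul, sub_neg_eq_add]
      exact eq_neg_of_add_eq_zero_left hsum
    have e₂ : (rootSystem H).reflectionPerm (j : H.root) γ = negRoot (i : H.root) := by
      apply (rootSystem H).root.injective
      rw [root_reflectionPerm_eq_sub, hγj, root_negRoot, neg_one_smul, sub_neg_eq_add]
      exact eq_neg_of_add_eq_zero_left (by rw [← hsum]; abel)
    have e₃ (k : H.root) : (rootSystem H).reflectionPerm k (negRoot k) = k := by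
      rw [negRoot_eq_reflectionPerm, RootPairing.reflectionPerm_self]
    have hneg (k : H.root) : (rootSystem H).pairingIn ℤ (negRoot k) k < 0 := by
      simp [pairingIn_negRoot]
    have s₁ : E.step i (γ, x) = (negRoot (j : H.root), E.simpleLift i x) := by
      rw [E.step_of_pairingIn_neg (p := (γ, x)) hi, e₁]
    have s₂ : E.step j (γ, x) = (negRoot (i : H.root), E.simpleLift j x) := by
      rw [E.step_of_pairingIn_neg (p := (γ, x)) hj, e₂]
    have s₃ (k : b.support) (y : L) :
        E.step k (negRoot (k : H.root), y) = ((k : H.root), E.simpleLift k y) := by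
      rw [E.step_of_pairingIn_neg (p := (negRoot (k : H.root), y)) (hneg (k : H.root)), e₃]
    rw [s₁, s₂, s₃, s₃]
    refine ⟨hneg (j : H.root), h', hneg (i : H.root), h, ?_⟩
    rw [E.step_of_pairingIn_neg (p := ((j : H.root), _)) h',
      E.step_of_pairingIn_neg (p := ((i : H.root), _)) h, E.simpleLift_braid hsum hij₁ hji₁ hp]
    congr 1
    apply (rootSystem H).root.injective
    rw [root_reflectionPerm_eq_sub, root_reflectionPerm_eq_sub, hij₁, hji₁]
    module
  · left
    have h' := (rootSystem H).pairingIn_eq_zero_iff.mp h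
    have hpij : (rootSystem H).pairing (i : H.root) (j : H.root) = 0 := by
      rw [← (rootSystem H).algebraMap_pairingIn ℤ, h, map_zero]
    have hpji : (rootSystem H).pairing (j : H.root) (i : H.root) = 0 := by
      rw [← (rootSystem H).algebraMap_pairingIn ℤ, h', map_zero]
    have fij : (rootSystem H).reflectionPerm (j : H.root) (i : H.root) = i :=
      RootPairing.reflectionPerm_eq_of_pairing_eq_zero hpij
    have fji : (rootSystem H).reflectionPerm (i : H.root) (j : H.root) = j :=
      RootPairing.reflectionPerm_eq_of_pairing_eq_zero hpji
    have gi : (rootSystem H).pairingIn ℤ ((rootSystem H).reflectionPerm (j : H.root) γ)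
        (i : H.root) = (rootSystem H).pairingIn ℤ γ (i : H.root) := by
      rw [← RootPairing.pairingIn_reflectionPerm, fij]
    have gj : (rootSystem H).pairingIn ℤ ((rootSystem H).reflectionPerm (i : H.root) γ)
        (j : H.root) = (rootSystem H).pairingIn ℤ γ (j : H.root) := by
      rw [← RootPairing.pairingIn_reflectionPerm, fji]
    have gi' := gi.trans_lt hi
    have gj' := gj.trans_lt hj
    have hcomm : E.simpleLift j (E.simpleLift i x) = E.simpleLift i (E.simpleLift j x) :=
      (LinearMap.congr_fun (E.commute_simpleLift hij h) x).symm
    rw [E.step_of_pairingIn_neg (p := (γ, x)) hi, E.step_of_pairingIn_neg (p := (γ, x)) hj]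
    refine ⟨gj', gi', ?_⟩
    rw [E.step_of_pairingIn_neg (p := ((rootSystem H).reflectionPerm (i : H.root) γ, _)) gj',
      E.step_of_pairingIn_neg (p := ((rootSystem H).reflectionPerm (j : H.root) γ, _)) gi', hcomm]
    congr 1
    apply (rootSystem H).root.injective
    simp only [root_reflectionPerm_eq_sub, gi, gj]
    abel

/-- Diamond lemma: induction applies to every higher root, and the chosen raise and the given one
meet again by `step_confluent`. -/
lemma normalForm_step_of_pairingIn_neg (hp : p.2 ∈ rootSpace H p.1.1)
    (hi : (rootSystem H).pairingIn ℤ p.1 (i : H.root) < 0) :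
    E.normalForm (E.step i p) = E.normalForm p := by
  induction hn : numAbove b p.1 using Nat.strong_induction_on generalizing p i with
  | _ n ih =>
  subst hn
  obtain ⟨j, hj, hN⟩ := E.exists_normalForm_eq ⟨i, hi⟩
  rw [hN]
  rcases eq_or_ne i j with rfl | hij
  · rfl
  have lt {q : H.root × L} {k : b.support}
      (h : (rootSystem H).pairingIn ℤ q.1 (k : H.root) < 0) :
      numAbove b (E.step k q).1 < numAbove b q.1 := numAbove_reflectionPerm_lt b h
  have hpi := step_mem (E := E) i hp
  have hpj := step_mem (E := E) j hp
  rcases E.step_confluent hp hij hi hj with ⟨h₁, h₂, h⟩ | ⟨h₁, h₂, h₃, h₄, h⟩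
  · rw [← ih _ (lt hi) hpi h₁ rfl, ← ih _ (lt hj) hpj h₂ rfl, h]
  · rw [← ih _ (lt hi) hpi h₁ rfl, ← ih _ ((lt h₁).trans (lt hi)) (step_mem j hpi) h₂ rfl,
      ← ih _ (lt hj) hpj h₃ rfl, ← ih _ ((lt h₃).trans (lt hj)) (step_mem i hpj) h₄ rfl, h]

lemma normalForm_step (hp : p.2 ∈ rootSpace H p.1.1) :
    E.normalForm (E.step i p) = E.normalForm p := by
  rcases lt_trichotomy ((rootSystem H).pairingIn ℤ p.1 (i : H.root)) 0 with h | h | h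
  · exact E.normalForm_step_of_pairingIn_neg hp h
  · rw [E.step_of_pairingIn_eq_zero hp h]
  · have h' : (rootSystem H).pairingIn ℤ (E.step i p).1 (i : H.root) < 0 := by
      rw [step, pairingIn_reflectionPerm_self]
      omega
    rw [← E.normalForm_step_of_pairingIn_neg (step_mem i hp) h', E.step_step hp]

/-- Both pairs are raised by the same letters until they are their own normal forms; injectivity of
steps brings the equality back. -/
lemma eq_of_normalForm_eq {q : H.root × L} (hpq : p.1 = q.1) (hp : p.2 ∈ rootSpace H p.1.1)
    (hq : q.2 ∈ rootSpace H q.1.1) (h : E.normalForm p = E.normalForm q) : p = q := by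
  induction hn : numAbove b p.1 using Nat.strong_induction_on generalizing p q with
  | _ n ih =>
  subst hn
  by_cases hex : ∃ i : b.support, (rootSystem H).pairingIn ℤ p.1 (i : H.root) < 0
  · obtain ⟨i, hi⟩ := hex
    rw [← E.normalForm_step (i := i) hp, ← E.normalForm_step (i := i) hq] at h
    have hlt : numAbove b (E.step i p).1 < numAbove b p.1 := numAbove_reflectionPerm_lt b hi
    have := ih _ hlt (by rw [step, step, hpq]) (step_mem i hp) (step_mem i hq) h rfl
    rw [← E.step_step (i := i) hp, this, E.step_step hq]
  · rwa [E.normalForm_eq_self hex, E.normalForm_eq_self (by rwa [← hpq])] at h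

/-! ### Kottwitz lifts as words of steps, and the Chevalley involution -/

lemma foldr_step_mem (l : List b.support) (hp : p.2 ∈ rootSpace H p.1.1) :
    (l.foldr E.step p).2 ∈ rootSpace H (l.foldr E.step p).1.1 := by
  induction l with
  | nil => exact hp
  | cons i l ih => exact step_mem i ih

lemma normalForm_foldr_step (l : List b.support) (hp : p.2 ∈ rootSpace H p.1.1) :
    E.normalForm (l.foldr E.step p) = E.normalForm p := by
  induction l with
  | nil => rfl
  | cons i l ih => rw [List.foldr_cons, E.normalForm_step (E.foldr_step_mem l hp), ih]

/-- The Kottwitz lift is the composite of the Kottwitz lifts of the simple reflections in a reduced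
expression. -/
lemma foldr_step_of_isReducedExpression {l : List b.support}
    (hl : IsReducedExpression b l (wordProd b l)) (β : H.root) (x : L) :
    l.foldr E.step (β, x) =
      (act (wordProd b l) β, (-1 : K) ^ cocycle b (wordProd b l) β • E.titsLift l x) := by
  induction l with
  | nil => rw [cocycle_nil]; simp [titsLift]
  | cons i l ih =>
    rw [List.foldr_cons, ih hl.tail, hl.cocycle_cons, wordProd_cons, act_mul, act_ofIdx]
    simp [step, titsLift, smul_smul, pow_add]

/-- The automorphism of the set of pairs of a root and a vector induced by the Chevalley
involution, with the sign that makes it commute with `step`. -/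
def twist (b : (rootSystem H).Base) (θ : L ≃ₗ⁅K⁆ L) (p : H.root × L) : H.root × L :=
  (negRoot p.1, (-1 : K) ^ (b.height p.1 - 1) • θ p.2)

lemma twist_step {θ : L ≃ₗ⁅K⁆ L} (hθ : E.IsChevalleyInvolution θ) (i : b.support)
    (p : H.root × L) : twist b θ (E.step i p) = E.step i (twist b θ p) := by
  refine Prod.ext ?_ ?_
  · apply (rootSystem H).root.injective
    simp only [twist, step]
    rw [root_negRoot, RootPairing.root_reflectionPerm, RootPairing.root_reflectionPerm,
      root_negRoot, map_neg]
  · have hsmul (c : K) (x : L) : θ (c • x) = c • θ x := θ.toLinearEquiv.map_smul c x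
    simp only [twist, step, hsmul, map_smul, E.map_simpleLift i hθ, smul_smul,
      neg_one_pow_term_negRoot, height_reflectionPerm b i.2]
    congr 1
    rw [sub_right_comm, zpow_sub₀ (by simp), div_eq_mul_inv, ← inv_zpow, inv_neg_one]
    ring

lemma twist_foldr_step {θ : L ≃ₗ⁅K⁆ L} (hθ : E.IsChevalleyInvolution θ) (l : List b.support)
    (p : H.root × L) : twist b θ (l.foldr E.step p) = l.foldr E.step (twist b θ p) := by
  induction l with
  | nil => rfl
  | cons i l ih => rw [List.foldr_cons, E.twist_step hθ, ih, List.foldr_cons]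

/-- Since ⟨α,α^∨⟩ = 2 is even and ht(α) = 1, neither side carries a sign. -/
lemma twist_e {θ : L ≃ₗ⁅K⁆ L} (hθ : E.IsChevalleyInvolution θ) (α : b.support) :
    twist b θ ((α : H.root), E.e α) = E.step α ((α : H.root), E.e α) := by
  refine Prod.ext (negRoot_eq_reflectionPerm _) ?_
  have h : (0 : ℤ) < (rootSystem H).pairingIn ℤ (α : H.root) (α : H.root) := by simp
  simp only [twist, step]
  rw [neg_one_pow_term_of_pairingIn_pos h, b.height_one_of_mem_support α.2, hθ.map_e,
    simpleLift_e, RootPairing.pairingIn_same]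
  simp

lemma IsKottwitzBasis.exists_foldr_step {E : Frame b} {D : Set H.root} {k : H.root → L}
    (hk : E.IsKottwitzBasis D k) (γ : H.root) :
    ∃ α : b.support, (α : H.root) ∈ D ∧ (∃ w : (rootSystem H).weylGroup, act w (α : H.root) = γ) ∧
      ∃ l : List b.support, (γ, k γ) = l.foldr E.step ((α : H.root), E.e α) := by
  obtain ⟨α, hα, w, rfl, T, ⟨l, hl, rfl⟩, hkγ⟩ := hk γ
  obtain rfl : wordProd b l = w := hl.1
  exact ⟨α, hα, ⟨_, rfl⟩, l, by rw [hkγ, E.foldr_step_of_isReducedExpression hl]; rfl⟩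

/-- The Chevalley involution maps a Kottwitz basis to itself up to sign. -/
lemma IsKottwitzBasis.map_chevalleyInvolution {E : Frame b} {D : Set H.root}
    (hD : IsOrbitChoice b D) {k : H.root → L} (hk : E.IsKottwitzBasis D k) {θ : L ≃ₗ⁅K⁆ L}
    (hθ : E.IsChevalleyInvolution θ) (γ : H.root) :
    θ (k γ) = (-1 : K) ^ (b.height γ - 1) • k (negRoot γ) := by
  obtain ⟨α, hα, ⟨w, hw⟩, l, hl⟩ := hk.exists_foldr_step γ
  obtain ⟨α', hα', hw', l', hl'⟩ := hk.exists_foldr_step (negRoot γ)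
  -- As s_γ γ = -γ, both roots lie in one orbit, so the starting simple roots coincide.
  have hαα' : α' = α := by
    refine Subtype.ext ((hD.2 (negRoot γ)).unique ⟨hα', hw'⟩ ⟨hα, ?_⟩)
    exact ⟨RootPairing.weylGroup.ofIdx _ γ * w, by
      rw [act_mul, hw, act_ofIdx, negRoot_eq_reflectionPerm]⟩
  subst hαα'
  have hmem : E.e α' ∈ rootSpace H (α' : H.root).1 := E.e_mem α'
  have htw := E.twist_foldr_step hθ l ((α' : H.root), E.e α')
  rw [← hl, E.twist_e hθ] at htw
  have hstep := step_mem (E := E) (p := ((α' : H.root), E.e α')) α' hmem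
  have hmem₁ := E.foldr_step_mem l hstep
  have hmem₂ := E.foldr_step_mem (p := ((α' : H.root), E.e α')) l' hmem
  rw [← htw] at hmem₁
  rw [← hl'] at hmem₂
  have hpair : twist b θ (γ, k γ) = (negRoot γ, k (negRoot γ)) := by
    refine E.eq_of_normalForm_eq rfl hmem₁ hmem₂ ?_
    rw [htw, hl', E.normalForm_foldr_step l hstep,
      E.normalForm_step (p := ((α' : H.root), E.e α')) hmem,
      E.normalForm_foldr_step (p := ((α' : H.root), E.e α')) l' hmem]
  have key : (-1 : K) ^ (b.height γ - 1) • θ (k γ) = k (negRoot γ) := congr_arg Prod.snd hpair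
  rw [← key, smul_smul, ← mul_zpow, neg_one_mul, neg_neg, one_zpow, one_smul]

end Frame

end

end KottwitzBasis

theorem mainTheorem3 {K L : Type*} [Field K] [CharZero K] [LieRing L] [LieAlgebra K L]
    [LieAlgebra.IsKilling K L] [FiniteDimensional K L]
    (H : LieSubalgebra K L) [H.IsCartanSubalgebra] [LieModule.IsTriangularizable K H L]
    (b : (LieAlgebra.IsKilling.rootSystem H).Base) (E : KottwitzBasis.Frame b)
    (D : Set H.root) (hD : KottwitzBasis.IsOrbitChoice b D)
    (k : H.root → L) (hk : E.IsKottwitzBasis D k)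
    (θ : L ≃ₗ⁅K⁆ L) (hθ : E.IsChevalleyInvolution θ) :
    (∀ γ : H.root, θ (k γ) = (-1 : K) ^ (b.height γ - 1) • k (KottwitzBasis.negRoot γ)) ∧
      ∀ α ∈ b.support, θ (k α) = k (KottwitzBasis.negRoot α) := by
  refine ⟨hk.map_chevalleyInvolution hD hθ, fun α hα ↦ ?_⟩
  rw [hk.map_chevalleyInvolution hD hθ, b.height_one_of_mem_support hα, sub_self, zpow_zero,
    one_smul]
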